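/- Let $X,U$ be finite sets and let $K(y|x,u)$ be a transition kernel from $X\times U$ to $X$. Let $$\mathcal G=\Big\{\nu\in\mathcal P(X\times U):\ \sum_{x,u}K(y|x,u)\nu(x,u)=\sum_u\nu(y,u)\ \ \forall y\in X\Big\}\subset\mathbb R^{X\times U}$$ be the state-action polytope, let $L$ be the linear space of directions of the affine hull of $\mathcal G$, and let $\mathrm{int}(\mathcal G)$ be the interior of $\mathcal G$ relative to its affine hull. For a function $F$ on $\mathrm{int}(\mathcal G)$, the derivatives $\nabla F(v)\in L$, $\nabla^2F(v)$, $\nabla^3F(v)$ are taken along directions in $L$; write $F^*(h)=\sup_{v\in\mathrm{int}(\mathcal G)}\{\langle h,v\rangle-F(v)\}$ for $h\in\mathbb R^{X\times U}$, with ordinary gradient $\nabla F^*$ and Hessian $\nabla^2F^*$, and $$D_F(v,w)=F(v)-F(w)-\langle\nabla F(w),v-w\rangle,\qquad \|f\|^*_h=\sqrt{\langle f,\nabla^2F^*(h)f\rangle}.$$ Assume that $F:\mathrm{int}(\mathcal G)\to\mathbb R$ is a self-concordant barrier for $\mathcal G$, i.e. $F$ is convex and $C^3$, $F(v)\to+\infty$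 as $v$ tends to a relative boundary point of $\mathcal G$, and $\nabla^3F(v)[h,h,h]\le 2(\nabla^2F(v)[h,h])^{3/2}$ for all $v\in\mathrm{int}(\mathcal G)$, $h\in L$. Assume moreover that $F$ is strictly convex on $\mathrm{int}(\mathcal G)$, that $F^*$ is strictly convex on $L$, that $\nabla F:\mathrm{int}(\mathcal G)\to L$ is a bijection with inverse $h\mapsto\nabla F^*(h)$, and that $\min F=0$. Let $\mathcal F$ be a class of functions $f:X\times U\to\mathbb R$, let $T\in\mathbb N$ and $\rho>0$, and let $\mathcal G'\subseteq\mathrm{int}(\mathcal G)$. Put $\nu_1=\arg\min F$ and, for $f_1,f_2,\dots\in\mathcal F$, $$\nu_t=\nabla F^*\big(\nabla F(\nu_{t-1})-\rho f_{t-1}\big),\qquad t\ge2 ,$$ so that $\nu_{t+1}$ is a function of $f_1,\dots,f_t$. Suppose that $\rho\,\|f_t\|^*_{\nabla F(\nu_t)}\le\frac12$ and $\|f_t\|^*_{\nabla F(\nu_t)}\le1$ for all $f_1,\dots,f_T\in\mathcal F$ and all $t=1,\dots,T$. Define, for $t=0,\dots,T$ and $f_1,\dots,f_t\in\mathcal F$,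 with values in $[-\infty,+\infty]$, $$\widehat V_T(\mathcal G'|f_1,\dots,f_t)=\sup_{\mu\in\mathcal G'}\Big\{\sum_{s=1}^t\langle\mu,-f_s\rangle+\frac1\rho D_F(\mu,\nu_{t+1})\Big\}+2\rho(T-t).$$ Then: 1. $\widehat V_T$ is an admissible relaxation for decisions in $\mathrm{int}(\mathcal G)$ and comparators in $\mathcal G'$: for all $0\le t<T$ and $f_1,\dots,f_t\in\mathcal F$, $$\widehat V_T(\mathcal G'|f_1,\dots,f_t)\ \ge\ \inf_{\nu\in\mathrm{int}(\mathcal G)}\ \sup_{f\in\mathcal F}\big\{\langle\nu,f\rangle+\widehat V_T(\mathcal G'|f_1,\dots,f_t,f)\big\},$$ and $\widehat V_T(\mathcal G'|f_1,\dots,f_T)\ge-\inf_{\nu\in\mathcal G'}\sum_{t=1}^T\langle\nu,f_t\rangle$ for all $f_1,\dots,f_T\in\mathcal F$. 2. The algorithm generating $\{\nu_t\}$ is admissible: for all $1\le t\le T$ and $f_1,\dots,f_{t-1}\in\mathcal F$, $\nu_t\in\mathrm{int}(\mathcal G)$ and $$\widehat V_T(\mathcal G'|f_1,\dots,f_{t-1})\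 \ge\ \sup_{f\in\mathcal F}\big\{\langle\nu_t,f\rangle+\widehat V_T(\mathcal G'|f_1,\dots,f_{t-1},f)\big\}.$$ 3. If $\nu_t\in\mathcal G'$ for all $1\le t\le T$ and all $f_1,\dots,f_{t-1}\in\mathcal F$, then the first inequality in 1 also holds with the infimum restricted to $\nu\in\mathcal G'$. -/

import Mathlib

open Filter Topology

open scoped InnerProductSpace

noncomputable section

namespace OnlineMDP

/-! ### Self-concordant barriers on a closed convex set

All notions below are relative to the affine hull of the convex set `𝒦`: `int` is the interior of
`𝒦` in its affine hull, and a function on `int 𝒦` is differentiated in the directions of that hull.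
If `𝒦` has nonempty interior in the whole space, then `vectorSpan ℝ 𝒦 = ⊤` and these are the usual
interior, gradient, Hessian and third derivative. -/

section Barrier

variable {ι : Type*} [Fintype ι]

/-- The interior of `𝒦` in its affine hull. -/
abbrev relInt (𝒦 : Set (EuclideanSpace ℝ ι)) : Set (EuclideanSpace ℝ ι) :=
  intrinsicInterior ℝ 𝒦

/-- The function `h ↦ F (v + h)` on the linear space of directions of the affine hull of `𝒦`.
For `v ∈ relInt 𝒦` its germ at `0` only involves the values of `F` on `relInt 𝒦`. -/
def localRep (𝒦 : Set (EuclideanSpace ℝ ι)) (F : EuclideanSpace ℝ ι → ℝ)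
    (v : EuclideanSpace ℝ ι) : vectorSpan ℝ 𝒦 → ℝ :=
  fun h => F (v + (h : EuclideanSpace ℝ ι))

/-- `∇F(v)`, as a vector in the direction space of the affine hull of `𝒦`. -/
def grad (𝒦 : Set (EuclideanSpace ℝ ι)) (F : EuclideanSpace ℝ ι → ℝ)
    (v : EuclideanSpace ℝ ι) : EuclideanSpace ℝ ι :=
  ((gradient (localRep 𝒦 F v) 0 : vectorSpan ℝ 𝒦) : EuclideanSpace ℝ ι)

/-- `∇²F(v)[h,h]`. -/
def hess (𝒦 : Set (EuclideanSpace ℝ ι)) (F : EuclideanSpace ℝ ι → ℝ)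
    (v : EuclideanSpace ℝ ι) (h : vectorSpan ℝ 𝒦) : ℝ :=
  iteratedFDeriv ℝ 2 (localRep 𝒦 F v) 0 (fun _ => h)

/-- `∇³F(v)[h,h,h]`. -/
def third (𝒦 : Set (EuclideanSpace ℝ ι)) (F : EuclideanSpace ℝ ι → ℝ)
    (v : EuclideanSpace ℝ ι) (h : vectorSpan ℝ 𝒦) : ℝ :=
  iteratedFDeriv ℝ 3 (localRep 𝒦 F v) 0 (fun _ => h)

/-- `F` is a self-concordant barrier on `𝒦`. -/
structure IsSelfConcordantBarrier (𝒦 : Set (EuclideanSpace ℝ ι))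
    (F : EuclideanSpace ℝ ι → ℝ) : Prop where
  convexOn : ConvexOn ℝ (relInt 𝒦) F
  contDiffAt : ∀ v ∈ relInt 𝒦, ContDiffAt ℝ 3 (localRep 𝒦 F v) 0
  third_le : ∀ v ∈ relInt 𝒦, ∀ h : vectorSpan ℝ 𝒦,
    third 𝒦 F v h ≤ 2 * (hess 𝒦 F v h) ^ (3 / 2 : ℝ)
  barrier : ∀ b ∈ intrinsicFrontier ℝ 𝒦, Tendsto F (𝓝[relInt 𝒦] b) atTop

/-- The Legendre--Fenchel dual `F*(h) = sup_{v ∈ int 𝒦} (⟨h,v⟩ - F(v))`.  The supremum is over a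
nonempty set that is bounded above as soon as `𝒦` is nonempty, convex and bounded and `F` is
bounded below on `relInt 𝒦`. -/
def dual (𝒦 : Set (EuclideanSpace ℝ ι)) (F : EuclideanSpace ℝ ι → ℝ)
    (h : EuclideanSpace ℝ ι) : ℝ :=
  ⨆ v : relInt 𝒦, (⟪h, (v : EuclideanSpace ℝ ι)⟫_ℝ - F v)

/-- `∇F*(h)`, an ordinary gradient in the whole space. -/
def dualGrad (𝒦 : Set (EuclideanSpace ℝ ι)) (F : EuclideanSpace ℝ ι → ℝ)
    (h : EuclideanSpace ℝ ι) : EuclideanSpace ℝ ι :=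
  gradient (dual 𝒦 F) h

/-- The dual local norm `‖f‖*_h = √⟨f, ∇²F*(h) f⟩`. -/
def dualLocalNorm (𝒦 : Set (EuclideanSpace ℝ ι)) (F : EuclideanSpace ℝ ι → ℝ)
    (h f : EuclideanSpace ℝ ι) : ℝ :=
  √(⟪f, fderiv ℝ (dualGrad 𝒦 F) h f⟫_ℝ)

/-- The Bregman divergence `D_F(v,w) = F(v) - F(w) - ⟨∇F(w), v - w⟩`. -/
def bregman (𝒦 : Set (EuclideanSpace ℝ ι)) (F : EuclideanSpace ℝ ι → ℝ)
    (v w : EuclideanSpace ℝ ι) : ℝ :=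
  F v - F w - ⟪grad 𝒦 F w, v - w⟫_ℝ

/-- The standing assumption on the barrier: `F` and its dual are strictly convex, `∇F` is a
bijection from `int 𝒦` onto the space of directions with inverse `∇F*`, and `min F = 0`. -/
structure IsMirrorBarrier (𝒦 : Set (EuclideanSpace ℝ ι))
    (F : EuclideanSpace ℝ ι → ℝ) : Prop extends IsSelfConcordantBarrier 𝒦 F where
  strictConvexOn : StrictConvexOn ℝ (relInt 𝒦) F
  dual_strictConvexOn : StrictConvexOn ℝ (vectorSpan ℝ 𝒦 : Set (EuclideanSpace ℝ ι)) (dual 𝒦 F)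
  grad_bijOn : Set.BijOn (grad 𝒦 F) (relInt 𝒦) (vectorSpan ℝ 𝒦 : Set (EuclideanSpace ℝ ι))
  grad_invOn : Set.InvOn (dualGrad 𝒦 F) (grad 𝒦 F) (relInt 𝒦)
    (vectorSpan ℝ 𝒦 : Set (EuclideanSpace ℝ ι))
  min_eq_zero : IsLeast (F '' relInt 𝒦) 0

/-! ### Relaxations for online linear optimization

A history `(f₁, …, f_t)` of cost functions is a list, in chronological order. -/

/-- `Vhat` is an admissible relaxation for horizon `T` and cost class `𝓕`, when the decisions are
taken in `D` and the regret is measured against the comparators in `C`. -/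
structure IsAdmissibleRelaxation (T : ℕ) (𝓕 D C : Set (EuclideanSpace ℝ ι))
    (Vhat : List (EuclideanSpace ℝ ι) → EReal) : Prop where
  step : ∀ h : List (EuclideanSpace ℝ ι), (∀ g ∈ h, g ∈ 𝓕) → h.length < T →
    (⨅ ν ∈ D, ⨆ f ∈ 𝓕, ((⟪ν, f⟫_ℝ : ℝ) : EReal) + Vhat (h ++ [f])) ≤ Vhat h
  terminal : ∀ h : List (EuclideanSpace ℝ ι), (∀ g ∈ h, g ∈ 𝓕) → h.length = T →
    -(⨅ ν ∈ C, (((h.map fun f => ⟪ν, f⟫_ℝ).sum : ℝ) : EReal)) ≤ Vhat h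

/-- The strategy `σ`, which plays `ν_{t+1} = σ (f₁, …, f_t) ∈ D`, is admissible for `Vhat`. -/
structure IsAdmissibleStrategy (T : ℕ) (𝓕 D : Set (EuclideanSpace ℝ ι))
    (Vhat : List (EuclideanSpace ℝ ι) → EReal)
    (σ : List (EuclideanSpace ℝ ι) → EuclideanSpace ℝ ι) : Prop where
  mem : ∀ h : List (EuclideanSpace ℝ ι), (∀ g ∈ h, g ∈ 𝓕) → h.length < T → σ h ∈ D
  step : ∀ h : List (EuclideanSpace ℝ ι), (∀ g ∈ h, g ∈ 𝓕) → h.length < T →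
    (⨆ f ∈ 𝓕, ((⟪σ h, f⟫_ℝ : ℝ) : EReal) + Vhat (h ++ [f])) ≤ Vhat h

/-- The mirror descent iterate `ν_{t+1}` after the history `(f₁, …, f_t)`, started at `ν₁`:
`ν_{s+1} = ∇F*(∇F(ν_s) - ρ f_s)`. -/
def mirrorIterate (𝒦 : Set (EuclideanSpace ℝ ι)) (F : EuclideanSpace ℝ ι → ℝ) (ρ : ℝ)
    (ν₁ : EuclideanSpace ℝ ι) (h : List (EuclideanSpace ℝ ι)) : EuclideanSpace ℝ ι :=
  h.foldl (fun ν f => dualGrad 𝒦 F (grad 𝒦 F ν - ρ • f)) ν₁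

/-- `sup_{μ ∈ C} {∑_{s ≤ t} ⟨μ, -f_s⟩ + D_F(μ, ν_{t+1}) / ρ} + 2ρ(T - t)`. -/
def mirrorRelaxation (𝒦 : Set (EuclideanSpace ℝ ι)) (F : EuclideanSpace ℝ ι → ℝ) (ρ : ℝ)
    (ν₁ : EuclideanSpace ℝ ι) (T : ℕ) (C : Set (EuclideanSpace ℝ ι))
    (h : List (EuclideanSpace ℝ ι)) : EReal :=
  (⨆ μ ∈ C, (((h.map fun f => ⟪μ, -f⟫_ℝ).sum
      + 1 / ρ * bregman 𝒦 F μ (mirrorIterate 𝒦 F ρ ν₁ h) : ℝ) : EReal))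
    + ((2 * ρ * ((T : ℝ) - (h.length : ℝ)) : ℝ) : EReal)

end Barrier

/-- The state-action polytope of the controlled transition law `K(y|x,u) = K x u y`: the
probability distributions `ν` on `X × U` with `∑_{x,u} K(y|x,u) ν(x,u) = ∑_u ν(y,u)` for all `y`. -/
def stateActionPolytope {X U : Type*} [Fintype X] [Fintype U] (K : X → U → stdSimplex ℝ X) :
    Set (EuclideanSpace ℝ (X × U)) :=
  {ν | (∀ p, 0 ≤ ν p) ∧ ∑ p, ν p = 1 ∧
    ∀ y, ∑ x, ∑ u, (K x u : X → ℝ) y * ν (x, u) = ∑ u, ν (y, u)}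

end OnlineMDP

end

noncomputable section

namespace OnlineMDP

/-! ### Differential inequalities -/

/-! This is a potential argument with potential `D_F(μ, ·) / ρ`. The gradient of `F` at the next
iterate `w` is the projection onto `L` of `∇F(v) - ρ f`, which gives the three-point identity
`D_F(μ,w) = D_F(μ,v) + D_F(v,w) + ρ⟨f, μ - v⟩`. After division by `ρ`, the linear term is exactly
the instantaneous regret against `μ`. The relaxation step therefore reduces to `D_F(v,w) ≤ 2ρ²`,
which is paid for by the loss of `2ρ` in the horizon term. At the end of the horizon, `D_F ≥ 0`
suffices.

The bound on `D_F(v,w)` comes from self-concordance (`bregman_le_two_mul_of_selfConcordant`). Along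
the path whose gradient is `y - s u`, the squared dual local norm `l` of `u` satisfies `l' ≤ 2
l^(3/2)`. Hence `l ≤ 4 l(0)` on `[0,1]` when `l(0) ≤ 1/4`, and integrating twice gives `D_F ≤ 2
l(0)`. Differentiating the path requires `∇F*` to be smooth; this follows from the inverse function
theorem, because strict convexity and self-concordance together make the Hessian definite.

These calculations take place in a chart on `L`. They transfer to the ambient space because `F*` is
affine in the directions orthogonal to `L`. -/

/-- A nonnegative solution of `a' ≤ 2 a ^ (3 / 2)` which starts at `0` stays at `0`. -/
theorem eq_zero_of_deriv_le_rpow {a a' : ℝ → ℝ} {δ : ℝ} (hδ : 0 ≤ δ)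
    (hd : ∀ t ∈ Set.Icc 0 δ, HasDerivAt a (a' t) t) (hnn : ∀ t ∈ Set.Icc 0 δ, 0 ≤ a t)
    (hle : ∀ t ∈ Set.Icc 0 δ, a' t ≤ 2 * a t ^ (3 / 2 : ℝ)) (h0 : a 0 = 0) :
    ∀ t ∈ Set.Icc 0 δ, a t = 0 := by
  have hcont : ContinuousOn a (Set.Icc 0 δ) := fun t ht => (hd t ht).continuousAt.continuousWithinAt
  obtain ⟨M, hM⟩ := isCompact_Icc.exists_bound_of_continuousOn hcont
  have hM0 : 0 ≤ M := (norm_nonneg _).trans (hM 0 ⟨le_rfl, hδ⟩)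
  -- Compactness bounds `a` by `M`, which makes the inequality linear; Grönwall with zero initial
  -- value then applies.
  have key : ∀ t ∈ Set.Icc 0 δ, a' t ≤ 2 * √M * a t := by
    intro t ht
    refine (hle t ht).trans ?_
    have hat := hnn t ht
    have haM : a t ≤ M := (le_abs_self _).trans (hM t ht)
    have : a t ^ (3 / 2 : ℝ) = a t * √(a t) := by
      rw [Real.sqrt_eq_rpow, show (3 / 2 : ℝ) = 1 + 1 / 2 by norm_num]
      rcases hat.eq_or_lt with h | h
      · rw [← h, Real.zero_rpow (by norm_num), zero_mul]
      · rw [Real.rpow_add h, Real.rpow_one]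
    rw [this]
    have := mul_le_mul_of_nonneg_left (Real.sqrt_le_sqrt haM) hat
    linarith
  have := le_gronwallBound_of_liminf_deriv_right_le (f := a) (f' := a') (δ := 0) (K := 2 * √M)
    (ε := 0) (a := 0) (b := δ) hcont
    (fun x hx r hr => ((hd x ⟨hx.1, hx.2.le⟩).hasDerivWithinAt).liminf_right_slope_le hr)
    h0.le (fun x hx => by rw [add_zero]; exact key x ⟨hx.1, hx.2.le⟩)
  intro t ht
  refine le_antisymm ((this t ht).trans ?_) (hnn t ht)
  simp [gronwallBound_ε0]

/-- A positive solution of `l' ≤ 2 l ^ (3 / 2)` grows at most by a factor `4` on `[0, 1]` if it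
starts below `1 / 4`. -/
theorem le_four_mul_of_deriv_le_rpow {l l' : ℝ → ℝ}
    (hd : ∀ t ∈ Set.Icc (0 : ℝ) 1, HasDerivAt l (l' t) t)
    (hpos : ∀ t ∈ Set.Icc (0 : ℝ) 1, 0 < l t)
    (hle : ∀ t ∈ Set.Icc (0 : ℝ) 1, l' t ≤ 2 * l t ^ (3 / 2 : ℝ)) (h0 : l 0 ≤ 1 / 4) :
    ∀ t ∈ Set.Icc (0 : ℝ) 1, l t ≤ 4 * l 0 := by
  intro s hs
  have hl0 : 0 < l 0 := hpos 0 ⟨le_rfl, zero_le_one⟩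
  -- The function `-l^(-1/2)` has slope at most `1`, so `l(s)^(-1/2) ≥ l(0)^(-1/2) - s`. The
  -- threshold `1/4` means `l(0)^(-1/2) ≥ 2`, so at most half is lost for `s ≤ 1`; squaring yields
  -- the factor `4`.
  have hm : ∀ t ∈ Set.Icc (0 : ℝ) 1, HasDerivAt (fun t => -(l t ^ (-(1 / 2) : ℝ)))
      (-(l' t * (-(1 / 2)) * l t ^ (-(1 / 2) - 1 : ℝ))) t := fun t ht =>
    ((hd t ht).rpow_const (Or.inl (hpos t ht).ne')).neg
  have h1 := image_le_of_deriv_right_le_deriv_boundary (a := (0 : ℝ)) (b := 1)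
    (fun t ht => (hm t ht).continuousAt.continuousWithinAt)
    (fun t ht => (hm t ⟨ht.1, ht.2.le⟩).hasDerivWithinAt)
    (B := fun t => t - l 0 ^ (-(1 / 2) : ℝ)) (B' := fun _ => 1) (by simp)
    (by fun_prop) (fun t _ => ((hasDerivAt_id t).sub_const _).hasDerivWithinAt)
    (fun t ht => by
      have ht' : t ∈ Set.Icc (0 : ℝ) 1 := ⟨ht.1, ht.2.le⟩
      have hp := hpos t ht'
      have h2 : l t ^ (3 / 2 : ℝ) * l t ^ (-(1 / 2) - 1 : ℝ) = 1 := by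
        rw [← Real.rpow_add hp]; norm_num
      have h3 := mul_le_mul_of_nonneg_right (hle t ht')
        (Real.rpow_nonneg hp.le (-(1 / 2) - 1 : ℝ))
      nlinarith) hs
  have e : ∀ x : ℝ, 0 < x → x ^ (-(1 / 2) : ℝ) = (√x)⁻¹ := fun x hx => by
    rw [Real.rpow_neg hx.le, Real.sqrt_eq_rpow]
  rw [e _ hl0, e _ (hpos s hs)] at h1
  have hr : 0 < √(l 0) := Real.sqrt_pos.2 hl0
  have hq : 0 < √(l s) := Real.sqrt_pos.2 (hpos s hs)
  have hr2 : √(l 0) ≤ 1 / 2 := by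
    rw [show (1 / 2 : ℝ) = √(1 / 4) by
      rw [show (1 / 4 : ℝ) = (1 / 2) ^ 2 by norm_num, Real.sqrt_sq (by norm_num)]]
    exact Real.sqrt_le_sqrt h0
  have hri : 2 ≤ (√(l 0))⁻¹ := by
    rw [le_inv_comm₀ two_pos hr]; linarith
  have h4 : (√(l 0))⁻¹ / 2 ≤ (√(l s))⁻¹ := by linarith [hs.2]
  have h5 : √(l s) ≤ 2 * √(l 0) := by
    have := (le_inv_comm₀ (by positivity) hq).1 h4
    rwa [inv_div, div_inv_eq_mul] at this
  calc l s = √(l s) ^ 2 := (Real.sq_sqrt (hpos s hs).le).symm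
    _ ≤ (2 * √(l 0)) ^ 2 := by gcongr
    _ = 4 * l 0 := by rw [mul_pow, Real.sq_sqrt hl0.le]; norm_num

/-! ### Convex functions on an open set -/

section Convex

variable {E : Type*} [NormedAddCommGroup E] [NormedSpace ℝ E] {Ω : Set E} {Φ : E → ℝ} {x y : E}

/-- A convex function lies above its tangents. -/
theorem fderiv_le_sub_of_convexOn (hc : ConvexOn ℝ Ω Φ) (hd : DifferentiableAt ℝ Φ x)
    (hx : x ∈ Ω) (hy : y ∈ Ω) : fderiv ℝ Φ x (y - x) ≤ Φ y - Φ x := by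
  have hc' := hc.comp_affineMap (AffineMap.lineMap x y : ℝ →ᵃ[ℝ] E)
  have h := hc'.le_slope_of_hasDerivAt (x := 0) (y := 1) (f' := fderiv ℝ Φ x (y - x))
    (by simpa using hx) (by simpa using hy) one_pos (by
      refine HasFDerivAt.comp_hasDerivAt (f := (AffineMap.lineMap x y : ℝ → E)) (0 : ℝ) ?_
        AffineMap.hasDerivAt_lineMap
      simpa using hd.hasFDerivAt)
  simpa [slope_def_field] using h

/-- The weak tangent inequality is used towards the midpoint, where strict convexity supplies the
strict gain. -/
theorem fderiv_lt_sub_of_strictConvexOn (hc : StrictConvexOn ℝ Ω Φ) (hd : DifferentiableAt ℝ Φ x)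
    (hx : x ∈ Ω) (hy : y ∈ Ω) (hxy : x ≠ y) : fderiv ℝ Φ x (y - x) < Φ y - Φ x := by
  have h1 := hc.2 hx hy hxy (show (0 : ℝ) < 1 / 2 by norm_num) (show (0 : ℝ) < 1 / 2 by norm_num)
    (by norm_num)
  have hm := hc.1 hx hy (show (0 : ℝ) ≤ 1 / 2 by norm_num) (show (0 : ℝ) ≤ 1 / 2 by norm_num)
    (by norm_num)
  have h2 := fderiv_le_sub_of_convexOn hc.convexOn hd hx hm
  rw [show (1 / 2 : ℝ) • x + (1 / 2 : ℝ) • y - x = (1 / 2 : ℝ) • (y - x) by module, map_smul] at h2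
  simp only [smul_eq_mul] at h1 h2
  linarith

theorem hasDerivAt_comp_line {F : Type*} [NormedAddCommGroup F] [NormedSpace ℝ F] {G : E → F}
    {v : E} {t : ℝ} (hG : DifferentiableAt ℝ G (x + t • v)) :
    HasDerivAt (fun t : ℝ => G (x + t • v)) (fderiv ℝ G (x + t • v) v) t := by
  have hl : HasDerivAt (fun t : ℝ => x + t • v) v t := by
    simpa using ((hasDerivAt_id t).smul_const v).const_add x
  exact hG.hasFDerivAt.comp_hasDerivAt t hl

theorem hasDerivAt_clm_apply_const {F G : Type*} [NormedAddCommGroup F] [NormedSpace ℝ F]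
    [NormedAddCommGroup G] [NormedSpace ℝ G] {A : ℝ → F →L[ℝ] G} {A' : F →L[ℝ] G} {t : ℝ}
    (hA : HasDerivAt A A' t) (z : F) : HasDerivAt (fun t => A t z) (A' z) t :=
  ((ContinuousLinearMap.apply ℝ G z).hasFDerivAt (x := A t)).comp_hasDerivAt t hA

theorem hasDerivAt_fderiv_line {v : E} {t : ℝ} (hs : ContDiffAt ℝ 3 Φ (x + t • v)) :
    HasDerivAt (fun t : ℝ => fderiv ℝ Φ (x + t • v) v)
      (fderiv ℝ (fderiv ℝ Φ) (x + t • v) v v) t :=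
  hasDerivAt_clm_apply_const (hasDerivAt_comp_line
    ((hs.fderiv_right (m := 2) (by norm_num)).differentiableAt (by norm_num))) v

theorem hasDerivAt_fderiv_fderiv_line {v : E} {t : ℝ} (hs : ContDiffAt ℝ 3 Φ (x + t • v)) :
    HasDerivAt (fun t : ℝ => fderiv ℝ (fderiv ℝ Φ) (x + t • v) v v)
      (fderiv ℝ (fderiv ℝ (fderiv ℝ Φ)) (x + t • v) v v v) t :=
  hasDerivAt_clm_apply_const (hasDerivAt_clm_apply_const (hasDerivAt_comp_line
    (((hs.fderiv_right (m := 2) (by norm_num)).fderiv_right (m := 1)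
      (by norm_num)).differentiableAt (by norm_num))) v) v

/-- Adding the tangent inequalities at two points shows that the slope is monotone along lines; the
second derivative is a limit of its nonnegative difference quotients. -/
theorem fderiv_fderiv_nonneg_of_convexOn (hΩ : IsOpen Ω) (hc : ConvexOn ℝ Ω Φ)
    (hs : ∀ x ∈ Ω, ContDiffAt ℝ 3 Φ x) (hx : x ∈ Ω) (v : E) :
    0 ≤ fderiv ℝ (fderiv ℝ Φ) x v v := by
  have hx0 : x + (0 : ℝ) • v = x := by simp
  have hd := (hasDerivAt_fderiv_line (x := x) (v := v) (t := 0)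
    (by rw [hx0]; exact hs x hx)).tendsto_slope_zero_right
  rw [hx0] at hd
  refine ge_of_tendsto hd ?_
  have hcont : Tendsto (fun t : ℝ => x + t • v) (𝓝[>] 0) (𝓝 x) := by
    have : Tendsto (fun t : ℝ => x + t • v) (𝓝 0) (𝓝 (x + (0 : ℝ) • v)) :=
      Continuous.tendsto (by fun_prop) 0
    rw [zero_smul, add_zero] at this
    exact this.mono_left nhdsWithin_le_nhds
  filter_upwards [hcont (hΩ.mem_nhds hx), self_mem_nhdsWithin] with t ht (ht0 : 0 < t)
  have ht : x + t • v ∈ Ω := ht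
  have h1 := fderiv_le_sub_of_convexOn hc ((hs x hx).differentiableAt (by norm_num)) hx ht
  have h2 := fderiv_le_sub_of_convexOn hc ((hs _ ht).differentiableAt (by norm_num)) ht hx
  rw [show x + t • v - x = t • v by module, map_smul, smul_eq_mul] at h1
  rw [show x - (x + t • v) = -(t • v) by module, map_neg, map_smul, smul_eq_mul] at h2
  simp only [zero_add, smul_eq_mul]
  have h3 : 0 ≤ t * (fderiv ℝ Φ (x + t • v) v - fderiv ℝ Φ x v) := by linarith
  exact mul_nonneg (by positivity) (nonneg_of_mul_nonneg_right h3 ht0)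

/-- The Hessian of a strictly convex self-concordant function is positive definite. -/
theorem fderiv_fderiv_pos_of_selfConcordant (hΩ : IsOpen Ω) (hc : StrictConvexOn ℝ Ω Φ)
    (hs : ∀ x ∈ Ω, ContDiffAt ℝ 3 Φ x)
    (h3 : ∀ x ∈ Ω, ∀ v, fderiv ℝ (fderiv ℝ (fderiv ℝ Φ)) x v v v
      ≤ 2 * (fderiv ℝ (fderiv ℝ Φ) x v v) ^ (3 / 2 : ℝ))
    (hx : x ∈ Ω) {v : E} (hv : v ≠ 0) : 0 < fderiv ℝ (fderiv ℝ Φ) x v v := by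
  refine (fderiv_fderiv_nonneg_of_convexOn hΩ hc.convexOn hs hx v).lt_of_ne' fun h0 => ?_
  have hcont : Continuous fun t : ℝ => x + t • v := by fun_prop
  obtain ⟨ε, hε, hball⟩ := Metric.isOpen_iff.1 (hΩ.preimage hcont) 0 (by simpa using hx)
  have hmem : ∀ t ∈ Set.Icc 0 (ε / 2), x + t • v ∈ Ω := fun t ht => hball (by
    rw [Metric.mem_ball, dist_zero_right, Real.norm_of_nonneg ht.1]; linarith [ht.2])
  -- A zero of the second derivative along the ray propagates to a whole segment. The slope is then
  -- constant there, which contradicts the two strict tangent inequalities between the endpoints.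
  have ha := eq_zero_of_deriv_le_rpow (a := fun t => fderiv ℝ (fderiv ℝ Φ) (x + t • v) v v)
    (δ := ε / 2) (by positivity)
    (fun t ht => hasDerivAt_fderiv_fderiv_line (hs _ (hmem t ht)))
    (fun t ht => fderiv_fderiv_nonneg_of_convexOn hΩ hc.convexOn hs (hmem t ht) v)
    (fun t ht => h3 _ (hmem t ht) v) (by simpa using h0)
  have hb := constant_of_has_deriv_right_zero
    (f := fun t : ℝ => fderiv ℝ Φ (x + t • v) v) (a := 0) (b := ε / 2)
    (fun t ht => (hasDerivAt_fderiv_line (hs _ (hmem t ht))).continuousAt.continuousWithinAt)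
    (fun t ht => ha t ⟨ht.1, ht.2.le⟩ ▸
      (hasDerivAt_fderiv_line (hs _ (hmem t ⟨ht.1, ht.2.le⟩))).hasDerivWithinAt)
    (ε / 2) ⟨by positivity, le_rfl⟩
  have hy := hmem (ε / 2) ⟨by positivity, le_rfl⟩
  have hne : x ≠ x + (ε / 2) • v := by
    simpa using ⟨hε.ne', hv⟩
  have h1 := fderiv_lt_sub_of_strictConvexOn hc ((hs x hx).differentiableAt (by norm_num)) hx hy hne
  have h2 := fderiv_lt_sub_of_strictConvexOn hc ((hs _ hy).differentiableAt (by norm_num)) hy hx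
    hne.symm
  rw [show x + (ε / 2) • v - x = (ε / 2) • v by module, map_smul, smul_eq_mul] at h1
  rw [show x - (x + (ε / 2) • v) = -((ε / 2) • v) by module, map_neg, map_smul, smul_eq_mul] at h2
  simp only [zero_smul, add_zero] at hb
  rw [hb] at h2
  linarith

end Convex

/-! ### Self-concordant functions with bijective gradient -/

section Inverse

variable {E : Type*} [NormedAddCommGroup E] [InnerProductSpace ℝ E] [CompleteSpace E]
  {Ω : Set E} {Φ : E → ℝ} {N : E → E}

theorem hasDerivAt_clm_apply {F G H : Type*} [NormedAddCommGroup F] [NormedSpace ℝ F]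
    [NormedAddCommGroup G] [NormedSpace ℝ G] [NormedAddCommGroup H] [NormedSpace ℝ H]
    {A : G → F →L[ℝ] H} {v : ℝ → G} {v' : G} {p : ℝ → F} {p' : F} {t : ℝ}
    (hA : DifferentiableAt ℝ A (v t)) (hv : HasDerivAt v v' t) (hp : HasDerivAt p p' t) :
    HasDerivAt (fun t => A (v t) (p t)) (fderiv ℝ A (v t) v' (p t) + A (v t) p') t :=
  (hA.hasFDerivAt.comp_hasDerivAt t hv).clm_apply hp

theorem contDiffAt_gradient {x : E} (hs : ContDiffAt ℝ 3 Φ x) : ContDiffAt ℝ 2 (gradient Φ) x :=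
  ((InnerProductSpace.toDual ℝ E).symm.toContinuousLinearEquiv.toContinuousLinearMap).contDiff
    |>.contDiffAt.comp x (hs.fderiv_right (m := 2) (by norm_num))

/-- The Riesz identification is linear and continuous, so it commutes with differentiation. This
turns definiteness of the Hessian into injectivity of the Jacobian of the gradient. -/
theorem inner_fderiv_gradient {x : E} (hs : ContDiffAt ℝ 3 Φ x) (v w : E) :
    ⟪fderiv ℝ (gradient Φ) x v, w⟫_ℝ = fderiv ℝ (fderiv ℝ Φ) x v w := by
  have h1 : HasFDerivAt (gradient Φ) (fderiv ℝ (gradient Φ) x) x :=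
    ((contDiffAt_gradient hs).differentiableAt (by norm_num)).hasFDerivAt
  have h2 := ((InnerProductSpace.toDual ℝ E).toContinuousLinearEquiv.toContinuousLinearMap
    ).hasFDerivAt.comp x h1
  have h3 : fderiv ℝ (fderiv ℝ Φ) x = _ :=
    HasFDerivAt.fderiv (h2.congr_of_eventuallyEq
      (Eventually.of_forall fun z => (toDual_gradient (f := Φ) (x := z)).symm))
  rw [h3]
  simp

/-- If the Hessian is positive definite, a global inverse of the gradient is of class `C²`. -/
theorem contDiff_inverse_gradient [FiniteDimensional ℝ E] (hΩ : IsOpen Ω)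
    (hs : ∀ x ∈ Ω, ContDiffAt ℝ 3 Φ x)
    (hpos : ∀ x ∈ Ω, ∀ v, v ≠ 0 → 0 < fderiv ℝ (fderiv ℝ Φ) x v v)
    (hN : ∀ y, N y ∈ Ω) (hGN : ∀ y, gradient Φ (N y) = y) (hNG : ∀ x ∈ Ω, N (gradient Φ x) = x) :
    ContDiff ℝ 2 N := by
  refine contDiff_iff_contDiffAt.2 fun y => ?_
  have hsy := hs _ (hN y)
  have hG : ContDiffAt ℝ 2 (gradient Φ) (N y) := contDiffAt_gradient hsy
  have hinj : Function.Injective (fderiv ℝ (gradient Φ) (N y)) := by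
    refine (injective_iff_map_eq_zero _).2 fun v hv => ?_
    by_contra hne
    have := hpos _ (hN y) v hne
    rw [← inner_fderiv_gradient hsy, hv, inner_zero_left] at this
    exact this.false
  let e : E ≃L[ℝ] E := (LinearEquiv.ofInjectiveEndo
    (fderiv ℝ (gradient Φ) (N y) : E →ₗ[ℝ] E) hinj).toContinuousLinearEquiv
  have he : HasFDerivAt (gradient Φ) (e : E →L[ℝ] E) (N y) := by
    have : (e : E →L[ℝ] E) = fderiv ℝ (gradient Φ) (N y) := by
      ext v
      rfl
    rw [this]
    exact (hG.differentiableAt (by norm_num)).hasFDerivAt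
  have hst : HasStrictFDerivAt (gradient Φ) (e : E →L[ℝ] E) (N y) :=
    hG.hasStrictFDerivAt' he (by norm_num)
  have hloc : ContDiffAt ℝ 2 (hst.localInverse (gradient Φ) e (N y)) (gradient Φ (N y)) :=
    hG.to_localInverse he (by norm_num)
  -- Near `y` the local inverse lands in `Ω`, where `N` undoes the gradient, so it coincides with
  -- `N`. No prior continuity of `N` is needed.
  have hev : ∀ᶠ z in 𝓝 (gradient Φ (N y)), hst.localInverse (gradient Φ) e (N y) z ∈ Ω :=
    hst.localInverse_continuousAt.eventually_mem
      (by rw [hst.localInverse_apply_image]; exact hΩ.mem_nhds (hN y))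
  have hr := hst.eventually_right_inverse
  rw [hGN y] at hloc hev hr
  refine hloc.congr_of_eventuallyEq ?_
  filter_upwards [hev, hr] with z hz hz'
  rw [← hNG _ hz, hz']

/-- The Bregman divergence of a self-concordant function along one gradient step, in terms of the
local norm of the step. -/
theorem bregman_le_two_mul_of_selfConcordant [FiniteDimensional ℝ E] (hΩ : IsOpen Ω)
    (hc : StrictConvexOn ℝ Ω Φ) (hs : ∀ x ∈ Ω, ContDiffAt ℝ 3 Φ x)
    (h3 : ∀ x ∈ Ω, ∀ v, fderiv ℝ (fderiv ℝ (fderiv ℝ Φ)) x v v v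
      ≤ 2 * (fderiv ℝ (fderiv ℝ Φ) x v v) ^ (3 / 2 : ℝ))
    (hN : ∀ y, N y ∈ Ω) (hGN : ∀ y, gradient Φ (N y) = y) (hNG : ∀ x ∈ Ω, N (gradient Φ x) = x)
    (y u : E) :
    0 ≤ ⟪u, fderiv ℝ N y u⟫_ℝ ∧ (⟪u, fderiv ℝ N y u⟫_ℝ ≤ 1 / 4 →
      Φ (N y) - Φ (N (y - u)) - fderiv ℝ Φ (N (y - u)) (N y - N (y - u))
        ≤ 2 * ⟪u, fderiv ℝ N y u⟫_ℝ) := by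
  have hpos : ∀ x ∈ Ω, ∀ v, v ≠ 0 → 0 < fderiv ℝ (fderiv ℝ Φ) x v v := fun x hx v hv =>
    fderiv_fderiv_pos_of_selfConcordant hΩ hc hs h3 hx hv
  have hNs : ContDiff ℝ 2 N := contDiff_inverse_gradient hΩ hs hpos hN hGN hNG
  -- For `u = 0` the path is constant and `l` vanishes, whereas the comparison argument needs `l >
  -- 0`.
  rcases eq_or_ne u 0 with rfl | hu
  · simp
  -- The path is straight in gradient coordinates: `gradient Φ (v s) = y - s • u`.
  obtain ⟨v, hvdef⟩ : ∃ v : ℝ → E, v = fun s => N (y - s • u) := ⟨_, rfl⟩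
  have hvΩ : ∀ s, v s ∈ Ω := fun s => hvdef ▸ hN _
  have hv : ContDiff ℝ 2 v := hvdef ▸ hNs.comp (by fun_prop)
  have hp : ContDiff ℝ 1 (deriv v) := ((contDiff_succ_iff_deriv (n := 1)).1 hv).2.2
  have hv1 : ∀ s, HasDerivAt v (deriv v s) s := fun s =>
    (hv.differentiable (by norm_num) s).hasDerivAt
  have hp1 : ∀ s, HasDerivAt (deriv v) (deriv (deriv v) s) s := fun s =>
    (hp.differentiable (by norm_num) s).hasDerivAt
  have hp0 : deriv v 0 = -fderiv ℝ N y u := by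
    have hl : HasDerivAt (fun s : ℝ => y - s • u) (-u) 0 := by
      simpa using ((hasDerivAt_id (0 : ℝ)).smul_const u).const_sub y
    have hN0 : HasFDerivAt N (fderiv ℝ N y) (y - (0 : ℝ) • u) := by
      rw [zero_smul, sub_zero]
      exact (hNs.differentiable (by norm_num) y).hasFDerivAt
    have h := hN0.comp_hasDerivAt (0 : ℝ) hl
    rw [map_neg] at h
    exact hvdef ▸ h.deriv
  -- first and second derivatives of the dual path
  have hD1 : ∀ s z, fderiv ℝ Φ (v s) z = ⟪y, z⟫_ℝ - s * ⟪u, z⟫_ℝ := fun s z => by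
    rw [← inner_gradient_left, hvdef, hGN, inner_sub_left, real_inner_smul_left]
  have hd2 : ∀ s, DifferentiableAt ℝ (fderiv ℝ Φ) (v s) := fun s =>
    ((hs _ (hvΩ s)).fderiv_right (m := 2) (by norm_num)).differentiableAt (by norm_num)
  have hd3 : ∀ s, DifferentiableAt ℝ (fderiv ℝ (fderiv ℝ Φ)) (v s) := fun s =>
    (((hs _ (hvΩ s)).fderiv_right (m := 2) (by norm_num)).fderiv_right (m := 1)
      (by norm_num)).differentiableAt (by norm_num)
  have hD2 : ∀ s z, fderiv ℝ (fderiv ℝ Φ) (v s) (deriv v s) z = -⟪u, z⟫_ℝ := fun s z => by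
    have h := hasDerivAt_clm_apply (hd2 s) (hv1 s) (hasDerivAt_const s z)
    rw [map_zero, add_zero] at h
    have h' : HasDerivAt (fun s => fderiv ℝ Φ (v s) z) (-⟪u, z⟫_ℝ) s := by
      simp only [hD1]
      simpa using ((hasDerivAt_id s).mul_const ⟪u, z⟫_ℝ).const_sub ⟪y, z⟫_ℝ
    exact h.unique h'
  have hD3 : ∀ s z, fderiv ℝ (fderiv ℝ (fderiv ℝ Φ)) (v s) (deriv v s) (deriv v s) z
      + fderiv ℝ (fderiv ℝ Φ) (v s) (deriv (deriv v) s) z = 0 := fun s z => by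
    have h := hasDerivAt_clm_apply_const (hasDerivAt_clm_apply (hd3 s) (hv1 s) (hp1 s)) z
    have h' : HasDerivAt (fun s => fderiv ℝ (fderiv ℝ Φ) (v s) (deriv v s) z) 0 s := by
      simp only [hD2]
      exact hasDerivAt_const s _
    exact h.unique h'
  have hsymm : ∀ s a b, fderiv ℝ (fderiv ℝ Φ) (v s) a b = fderiv ℝ (fderiv ℝ Φ) (v s) b a :=
    fun s a b => ((hs _ (hvΩ s)).isSymmSndFDerivAt (by simp; norm_num)).eq a b
  obtain ⟨l, hldef⟩ : ∃ l : ℝ → ℝ, l = fun s => -⟪u, deriv v s⟫_ℝ := ⟨_, rfl⟩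
  have hlH : ∀ s, l s = fderiv ℝ (fderiv ℝ Φ) (v s) (deriv v s) (deriv v s) := fun s =>
    hldef ▸ (hD2 s _).symm
  have hpne : ∀ s, deriv v s ≠ 0 := fun s h0 => by
    have := hD2 s u
    rw [h0] at this
    simp [hu] at this
  have hlpos : ∀ s, 0 < l s := fun s => hlH s ▸ hpos _ (hvΩ s) _ (hpne s)
  have hl' : ∀ s, HasDerivAt l (-⟪u, deriv (deriv v) s⟫_ℝ) s := fun s => by
    rw [hldef]
    exact ((hasDerivAt_const s u).inner ℝ (hp1 s)).neg.congr_deriv (by simp)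
  have hl'le : ∀ s, -⟪u, deriv (deriv v) s⟫_ℝ ≤ 2 * l s ^ (3 / 2 : ℝ) := fun s => by
    have h1 := hD3 s (deriv v s)
    rw [hsymm, hD2] at h1
    -- By `hD3` and symmetry of the Hessian, `l'` is minus the third derivative along `v'`; the
    -- one-sided bound is therefore applied to `-v'`.
    have h2 := h3 _ (hvΩ s) (-deriv v s)
    simp only [map_neg, neg_apply, neg_neg, ← hlH] at h2
    linarith
  have hl0 : l 0 = ⟪u, fderiv ℝ N y u⟫_ℝ := by rw [hldef]; simp [hp0]
  rw [← hl0]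
  refine ⟨(hlpos 0).le, fun hle => ?_⟩
  have hl4 := le_four_mul_of_deriv_le_rpow (fun t _ => hl' t) (fun t _ => hlpos t)
    (fun t _ => hl'le t) hle
  -- integrate twice
  have hq : ∀ s, HasDerivAt (fun s => ⟪u, v 0 - v s⟫_ℝ) (l s) s := fun s => by
    simpa [hldef] using (hasDerivAt_const s u).inner ℝ ((hv1 s).const_sub (v 0))
  have hq4 : ∀ s ∈ Set.Icc (0 : ℝ) 1, ⟪u, v 0 - v s⟫_ℝ ≤ 4 * l 0 * s := fun s hs' =>
    image_le_of_deriv_right_le_deriv_boundary (a := (0 : ℝ)) (b := 1)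
      (fun t _ => (hq t).continuousAt.continuousWithinAt)
      (fun t _ => (hq t).hasDerivWithinAt) (B := fun s => 4 * l 0 * s) (B' := fun _ => 4 * l 0)
      (by simp) (by fun_prop)
      (fun t _ => by simpa using ((hasDerivAt_id t).const_mul (4 * l 0)).hasDerivWithinAt)
      (fun t ht => hl4 t ⟨ht.1, ht.2.le⟩) hs'
  -- The terms in `fderiv ℝ Φ (v s) (deriv v s)` cancel, leaving the quantity already bounded by `4
  -- l(0) s`.
  have hB : ∀ s, HasDerivAt (fun s => Φ (v 0) - Φ (v s) - fderiv ℝ Φ (v s) (v 0 - v s))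
      ⟪u, v 0 - v s⟫_ℝ s := fun s => by
    have hΦ := ((hs _ (hvΩ s)).differentiableAt (by norm_num)).hasFDerivAt.comp_hasDerivAt s (hv1 s)
    have hF : HasDerivAt (fun s => fderiv ℝ Φ (v s) (v 0 - v s))
        (-⟪u, v 0 - v s⟫_ℝ - fderiv ℝ Φ (v s) (deriv v s)) s := by
      simp only [hD1]
      have h1 := (hasDerivAt_const s y).inner ℝ ((hv1 s).const_sub (v 0))
      have h2 := (hasDerivAt_id s).mul (hq s)
      refine (h1.sub h2).congr_deriv ?_
      simp [hldef]
      ring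
    refine ((hΦ.const_sub (Φ (v 0))).sub hF).congr_deriv ?_
    ring
  have hfin := image_le_of_deriv_right_le_deriv_boundary (a := (0 : ℝ)) (b := 1)
      (fun t _ => (hB t).continuousAt.continuousWithinAt)
      (fun t _ => (hB t).hasDerivWithinAt) (B := fun s => 2 * l 0 * s ^ 2)
      (B' := fun s => 4 * l 0 * s)
      (by simp) (by fun_prop)
      (fun t _ => (((hasDerivAt_pow 2 t).const_mul (2 * l 0)).congr_deriv
        (by push_cast; ring)).hasDerivWithinAt)
      (fun t ht => hq4 t ⟨ht.1, ht.2.le⟩) (x := 1) ⟨zero_le_one, le_rfl⟩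
  simpa [hvdef] using hfin

end Inverse

section Transfer

variable {ι : Type*} [Fintype ι] {𝒦 : Set (EuclideanSpace ℝ ι)} {F : EuclideanSpace ℝ ι → ℝ}
  {v w : EuclideanSpace ℝ ι}

/-! ### Coordinates on the affine hull -/

/-- The relative interior, translated by `-v` into the space of directions. -/
def chart (𝒦 : Set (EuclideanSpace ℝ ι)) (v : EuclideanSpace ℝ ι) : Set (vectorSpan ℝ 𝒦) :=
  {x | v + (x : EuclideanSpace ℝ ι) ∈ relInt 𝒦}

/-- The relative interior is an interior in the subtype `affineSpan ℝ 𝒦`, and the chart is its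
preimage under `x ↦ v + x`. -/
theorem isOpen_chart (hv : v ∈ relInt 𝒦) : IsOpen (chart 𝒦 v) := by
  have hva : v ∈ affineSpan ℝ 𝒦 := subset_affineSpan ℝ 𝒦 (intrinsicInterior_subset hv)
  have hmem : ∀ x : vectorSpan ℝ 𝒦, v + (x : EuclideanSpace ℝ ι) ∈ affineSpan ℝ 𝒦 := fun x => by
    rw [add_comm]
    exact AffineSubspace.vadd_mem_of_mem_direction
      (by rw [direction_affineSpan]; exact x.2) hva
  let φ : vectorSpan ℝ 𝒦 → affineSpan ℝ 𝒦 := fun x => ⟨v + x, hmem x⟩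
  have hφ : Continuous φ := by
    refine Continuous.subtype_mk ?_ _
    fun_prop
  have : chart 𝒦 v = φ ⁻¹' interior ((↑) ⁻¹' 𝒦) := by
    ext x
    constructor
    · rintro ⟨z, hz, hzx⟩
      have : φ x = z := Subtype.ext hzx.symm
      rwa [Set.mem_preimage, this]
    · intro hx
      exact ⟨φ x, hx, rfl⟩
  rw [this]
  exact isOpen_interior.preimage hφ

theorem sub_mem_vectorSpan (hv : v ∈ relInt 𝒦) (hw : w ∈ relInt 𝒦) :
    w - v ∈ vectorSpan ℝ 𝒦 :=
  vsub_mem_vectorSpan ℝ (intrinsicInterior_subset hw) (intrinsicInterior_subset hv)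

/-- Charts at different points are translates, so derivatives at `0` in varying charts become
derivatives at `x` in one fixed chart. -/
theorem localRep_add (x : vectorSpan ℝ 𝒦) :
    localRep 𝒦 F (v + (x : EuclideanSpace ℝ ι)) = fun h => localRep 𝒦 F v (x + h) := by
  funext h
  simp [localRep, add_assoc]

theorem grad_add (x : vectorSpan ℝ 𝒦) :
    grad 𝒦 F (v + (x : EuclideanSpace ℝ ι)) = gradient (localRep 𝒦 F v) x := by
  rw [grad, localRep_add, gradient, gradient, fderiv_comp_add_left, add_zero]

theorem contDiffAt_localRep (hF : IsSelfConcordantBarrier 𝒦 F) {x : vectorSpan ℝ 𝒦}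
    (hx : x ∈ chart 𝒦 v) : ContDiffAt ℝ 3 (localRep 𝒦 F v) x := by
  have h := hF.contDiffAt _ hx
  rw [localRep_add] at h
  have h2 : ContDiffAt ℝ 3 (fun y => y - x) x := by fun_prop
  have h3 := ContDiffAt.comp x (g := fun h => localRep 𝒦 F v (x + h)) (by simpa using h) h2
  simpa [Function.comp_def] using h3

theorem third_localRep_le (hF : IsSelfConcordantBarrier 𝒦 F) {x : vectorSpan ℝ 𝒦}
    (hx : x ∈ chart 𝒦 v) (z : vectorSpan ℝ 𝒦) :
    fderiv ℝ (fderiv ℝ (fderiv ℝ (localRep 𝒦 F v))) x z z z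
      ≤ 2 * (fderiv ℝ (fderiv ℝ (localRep 𝒦 F v)) x z z) ^ (3 / 2 : ℝ) := by
  have h := hF.third_le _ hx z
  rw [third, hess, localRep_add, iteratedFDeriv_comp_add_left, iteratedFDeriv_comp_add_left,
    add_zero, iteratedFDeriv_two_apply, iteratedFDeriv_succ_apply_right,
    iteratedFDeriv_two_apply] at h
  simpa [Fin.init] using h

theorem strictConvexOn_localRep (hF : StrictConvexOn ℝ (relInt 𝒦) F) :
    StrictConvexOn ℝ (chart 𝒦 v) (localRep 𝒦 F v) := by
  have key : ∀ (a b : ℝ) (x y : vectorSpan ℝ 𝒦), a + b = 1 →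
      v + ((a • x + b • y : vectorSpan ℝ 𝒦) : EuclideanSpace ℝ ι)
        = a • (v + (x : EuclideanSpace ℝ ι)) + b • (v + (y : EuclideanSpace ℝ ι)) := by
    intro a b x y hab
    obtain rfl : b = 1 - a := by linarith
    push_cast
    module
  refine ⟨fun x hx y hy a b ha hb hab => ?_, fun x hx y hy hxy a b ha hb hab => ?_⟩
  · rw [chart, Set.mem_ofPred_eq, key a b x y hab]
    exact hF.1 hx hy ha hb hab
  · rw [localRep, key a b x y hab]
    exact hF.2 hx hy (by simpa using hxy) ha hb hab

/-! ### The dual function -/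

/-- A real supremum of an unbounded family defaults to `0`, so boundedness must be known before the
dual can be manipulated. -/
theorem bddAbove_dual (hb : Bornology.IsBounded 𝒦) (hmin : IsLeast (F '' relInt 𝒦) 0)
    (h : EuclideanSpace ℝ ι) :
    BddAbove (Set.range fun v : relInt 𝒦 => ⟪h, (v : EuclideanSpace ℝ ι)⟫_ℝ - F v) := by
  obtain ⟨R, hR⟩ := hb.exists_norm_le
  refine ⟨‖h‖ * R, ?_⟩
  rintro _ ⟨v, rfl⟩
  have h1 := real_inner_le_norm h (v : EuclideanSpace ℝ ι)
  have h2 := mul_le_mul_of_nonneg_left (hR _ (intrinsicInterior_subset v.2)) (norm_nonneg h)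
  have h3 : 0 ≤ F v := hmin.2 ⟨v, v.2, rfl⟩
  simp only
  linarith

/-- The dual function is affine in the directions orthogonal to the affine hull. -/
theorem dual_add_of_mem_orthogonal (hb : Bornology.IsBounded 𝒦)
    (hmin : IsLeast (F '' relInt 𝒦) 0) (hv : v ∈ relInt 𝒦) {n : EuclideanSpace ℝ ι}
    (hn : n ∈ (vectorSpan ℝ 𝒦)ᗮ) (h : EuclideanSpace ℝ ι) :
    dual 𝒦 F (h + n) = dual 𝒦 F h + ⟪n, v⟫_ℝ := by
  have : Nonempty (relInt 𝒦) := ⟨⟨v, hv⟩⟩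
  rw [dual, dual, ciSup_add (bddAbove_dual hb hmin h)]
  congr 1
  funext w
  have : ⟪n, (w : EuclideanSpace ℝ ι) - v⟫_ℝ = 0 :=
    Submodule.inner_left_of_mem_orthogonal (sub_mem_vectorSpan hv w.2) hn
  rw [inner_sub_right] at this
  rw [inner_add_left]
  linarith

/-- Translation by a vector orthogonal to `L` changes `F*` by a constant only. This matters because
`∇F(ν) - ρ f` may leave `L`, while the inverse relation for `∇F*` is assumed on `L` alone. -/
theorem dualGrad_projection (hF : IsMirrorBarrier 𝒦 F) (hb : Bornology.IsBounded 𝒦)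
    (h : EuclideanSpace ℝ ι) :
    dualGrad 𝒦 F ((vectorSpan ℝ 𝒦).orthogonalProjectionOnto h) = dualGrad 𝒦 F h := by
  obtain ⟨v, hv, -⟩ := hF.min_eq_zero.1
  set n : EuclideanSpace ℝ ι := h - (vectorSpan ℝ 𝒦).orthogonalProjectionOnto h with hn
  have hn' : n ∈ (vectorSpan ℝ 𝒦)ᗮ := Submodule.sub_starProjection_mem_orthogonal h
  have h1 : (fun x => dual 𝒦 F (x + n)) = fun x => dual 𝒦 F x + ⟪n, v⟫_ℝ :=
    funext fun x => dual_add_of_mem_orthogonal hb hF.min_eq_zero hv hn' x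
  have h2 : h = (vectorSpan ℝ 𝒦).orthogonalProjectionOnto h + n := by rw [hn]; abel
  conv_rhs => rw [h2]
  rw [dualGrad, dualGrad, gradient, gradient, ← fderiv_comp_add_right, h1, fderiv_add_const]

theorem dualGrad_mem (hF : IsMirrorBarrier 𝒦 F) (hb : Bornology.IsBounded 𝒦)
    (h : EuclideanSpace ℝ ι) : dualGrad 𝒦 F h ∈ relInt 𝒦 := by
  rw [← dualGrad_projection hF hb]
  obtain ⟨w, hw, hwh⟩ := hF.grad_bijOn.surjOn
    ((vectorSpan ℝ 𝒦).orthogonalProjectionOnto h).2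
  rw [← hwh, hF.grad_invOn.1 hw]
  exact hw

theorem grad_dualGrad (hF : IsMirrorBarrier 𝒦 F) (hb : Bornology.IsBounded 𝒦)
    (h : EuclideanSpace ℝ ι) :
    grad 𝒦 F (dualGrad 𝒦 F h) = (vectorSpan ℝ 𝒦).orthogonalProjectionOnto h := by
  rw [← dualGrad_projection hF hb]
  exact hF.grad_invOn.2 ((vectorSpan ℝ 𝒦).orthogonalProjectionOnto h).2

/-! ### Bregman divergences -/

theorem inner_grad_sub (hv : v ∈ relInt 𝒦) (hw : w ∈ relInt 𝒦) :
    ⟪grad 𝒦 F w, v - w⟫_ℝ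
      = fderiv ℝ (localRep 𝒦 F w) 0 ⟨v - w, sub_mem_vectorSpan hw hv⟩ := by
  rw [← inner_gradient_left]
  rfl

theorem bregman_nonneg (hF : IsSelfConcordantBarrier 𝒦 F) (hc : StrictConvexOn ℝ (relInt 𝒦) F)
    (hv : v ∈ relInt 𝒦) (hw : w ∈ relInt 𝒦) : 0 ≤ bregman 𝒦 F v w := by
  have h0 : (0 : vectorSpan ℝ 𝒦) ∈ chart 𝒦 w := by simpa [chart] using hw
  have h := fderiv_le_sub_of_convexOn (strictConvexOn_localRep (v := w) hc).convexOn
    ((contDiffAt_localRep hF h0).differentiableAt (by norm_num)) h0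
    (y := ⟨v - w, sub_mem_vectorSpan hw hv⟩) (by simpa [chart] using hv)
  rw [sub_zero, ← inner_grad_sub hv hw] at h
  simp only [localRep, add_sub_cancel, ZeroMemClass.coe_zero, add_zero] at h
  rw [bregman]
  linarith

/-- The Bregman divergence of one step of mirror descent, bounded by the local norm of the cost. -/
theorem bregman_dualGrad_le (hF : IsMirrorBarrier 𝒦 F) (hb : Bornology.IsBounded 𝒦)
    (hv : v ∈ relInt 𝒦) {ρ : ℝ} (hρ : 0 ≤ ρ) (f : EuclideanSpace ℝ ι)
    (hf : ρ * dualLocalNorm 𝒦 F (grad 𝒦 F v) f ≤ 1 / 2) :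
    bregman 𝒦 F v (dualGrad 𝒦 F (grad 𝒦 F v - ρ • f))
      ≤ 2 * (ρ * dualLocalNorm 𝒦 F (grad 𝒦 F v) f) ^ 2 := by
  set P := (vectorSpan ℝ 𝒦).orthogonalProjectionOnto with hP
  -- This is `∇F*` read in the chart centred at `v`.
  let N : vectorSpan ℝ 𝒦 → vectorSpan ℝ 𝒦 := fun y =>
    ⟨dualGrad 𝒦 F y - v, sub_mem_vectorSpan hv (dualGrad_mem hF hb y)⟩
  have hvN : ∀ y, v + (N y : EuclideanSpace ℝ ι) = dualGrad 𝒦 F y := fun y => by simp [N]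
  have hN : ∀ y, N y ∈ chart 𝒦 v := fun y => by
    rw [chart, Set.mem_ofPred_eq, hvN]
    exact dualGrad_mem hF hb y
  have hGN : ∀ y, gradient (localRep 𝒦 F v) (N y) = y := fun y => Subtype.ext (by
    rw [← grad_add, hvN]
    exact hF.grad_invOn.2 y.2)
  have hNG : ∀ x ∈ chart 𝒦 v, N (gradient (localRep 𝒦 F v) x) = x := fun x hx => Subtype.ext (by
    simp only [N]
    rw [← grad_add, hF.grad_invOn.1 hx, add_sub_cancel_left])
  have hΩ := isOpen_chart hv
  have hc := strictConvexOn_localRep (v := v) hF.strictConvexOn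
  have hs : ∀ x ∈ chart 𝒦 v, ContDiffAt ℝ 3 (localRep 𝒦 F v) x := fun x hx =>
    contDiffAt_localRep hF.toIsSelfConcordantBarrier hx
  have h3 : ∀ x ∈ chart 𝒦 v, ∀ z, fderiv ℝ (fderiv ℝ (fderiv ℝ (localRep 𝒦 F v))) x z z z
      ≤ 2 * (fderiv ℝ (fderiv ℝ (localRep 𝒦 F v)) x z z) ^ (3 / 2 : ℝ) := fun x hx z =>
    third_localRep_le hF.toIsSelfConcordantBarrier hx z
  have hNs : ContDiff ℝ 2 N := contDiff_inverse_gradient hΩ hs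
    (fun x hx z hz => fderiv_fderiv_pos_of_selfConcordant hΩ hc hs h3 hx hz) hN hGN hNG
  -- the local norm in the chart
  let y : vectorSpan ℝ 𝒦 := ⟨grad 𝒦 F v, hF.grad_bijOn.mapsTo hv⟩
  have hPy : P (grad 𝒦 F v) = y :=
    Submodule.orthogonalProjectionOnto_mem_subspace_eq_self y
  -- Factoring through `P` identifies the ambient dual norm of `f` with the chart norm of `P f`.
  have hdual : dualGrad 𝒦 F = fun x => v + (vectorSpan ℝ 𝒦).subtypeL (N (P x)) := by
    funext x
    rw [← dualGrad_projection hF hb x]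
    exact (hvN _).symm
  have hfd : HasFDerivAt (dualGrad 𝒦 F)
      ((vectorSpan ℝ 𝒦).subtypeL ∘L (fderiv ℝ N y ∘L P)) (grad 𝒦 F v) := by
    rw [hdual]
    have h1 : HasFDerivAt N (fderiv ℝ N y) (P (grad 𝒦 F v)) := by
      rw [hPy]
      exact (hNs.differentiable (by norm_num) y).hasFDerivAt
    have h2 : HasFDerivAt (fun x => N (P x)) (fderiv ℝ N y ∘L P) (grad 𝒦 F v) :=
      h1.comp _ P.hasFDerivAt
    exact ((vectorSpan ℝ 𝒦).subtypeL.hasFDerivAt.comp _ h2).const_add v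
  have hinner : ⟪f, fderiv ℝ (dualGrad 𝒦 F) (grad 𝒦 F v) f⟫_ℝ
      = ⟪P f, fderiv ℝ N y (P f)⟫_ℝ := by
    rw [hfd.fderiv]
    exact (Submodule.inner_orthogonalProjectionOnto_eq_of_mem_right _ f).symm
  -- Only nonnegativity is taken here, so that squaring undoes the root in `dualLocalNorm`; the
  -- bound itself is used for `ρ • P f`.
  obtain ⟨hnn, -⟩ := bregman_le_two_mul_of_selfConcordant hΩ hc hs h3 hN hGN hNG y (P f)
  have hnorm : dualLocalNorm 𝒦 F (grad 𝒦 F v) f ^ 2 = ⟪P f, fderiv ℝ N y (P f)⟫_ℝ := by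
    rw [dualLocalNorm, hinner, Real.sq_sqrt hnn]
  have hu : ⟪ρ • P f, fderiv ℝ N y (ρ • P f)⟫_ℝ
      = (ρ * dualLocalNorm 𝒦 F (grad 𝒦 F v) f) ^ 2 := by
    rw [map_smul, real_inner_smul_left, real_inner_smul_right, ← hnorm]
    ring
  obtain ⟨-, hle⟩ := bregman_le_two_mul_of_selfConcordant hΩ hc hs h3 hN hGN hNG y (ρ • P f)
  rw [hu] at hle
  have hr : 0 ≤ ρ * dualLocalNorm 𝒦 F (grad 𝒦 F v) f := mul_nonneg hρ (Real.sqrt_nonneg _)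
  have hle := hle (by nlinarith)
  -- back to the original coordinates
  have hstep : dualGrad 𝒦 F (grad 𝒦 F v - ρ • f) = v + (N (y - ρ • P f) : EuclideanSpace ℝ ι) := by
    rw [hvN, ← dualGrad_projection hF hb, map_sub, map_smul, ← hP, hPy]
  have hvy : v + (N y : EuclideanSpace ℝ ι) = v := by
    rw [hvN]
    exact hF.grad_invOn.1 hv
  have e1 : localRep 𝒦 F v (N y) = F v := by rw [localRep, hvy]
  rw [← inner_gradient_left] at hle
  rw [bregman, hstep, grad_add]
  have e2 : v - (v + (N (y - ρ • P f) : EuclideanSpace ℝ ι))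
      = ((N y - N (y - ρ • P f) : vectorSpan ℝ 𝒦) : EuclideanSpace ℝ ι) := by
    rw [Submodule.coe_sub, show (N y : EuclideanSpace ℝ ι) = 0 by simpa using hvy]
    abel
  rw [e2, ← Submodule.coe_inner]
  rw [e1] at hle
  exact hle

/-- One step of mirror descent decreases the potential `D_F(μ, ·) / ρ` by the instantaneous regret,
up to `2ρ`. -/
theorem inner_add_bregman_dualGrad_le (hF : IsMirrorBarrier 𝒦 F) (hb : Bornology.IsBounded 𝒦)
    {μ : EuclideanSpace ℝ ι} (hμ : μ ∈ relInt 𝒦) (hv : v ∈ relInt 𝒦) {ρ : ℝ} (hρ : 0 < ρ)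
    (f : EuclideanSpace ℝ ι) (hf : ρ * dualLocalNorm 𝒦 F (grad 𝒦 F v) f ≤ 1 / 2)
    (hf1 : dualLocalNorm 𝒦 F (grad 𝒦 F v) f ≤ 1) :
    ⟪v, f⟫_ℝ + ⟪μ, -f⟫_ℝ + 1 / ρ * bregman 𝒦 F μ (dualGrad 𝒦 F (grad 𝒦 F v - ρ • f))
      ≤ 1 / ρ * bregman 𝒦 F μ v + 2 * ρ := by
  set w := dualGrad 𝒦 F (grad 𝒦 F v - ρ • f) with hw
  have h1 := bregman_dualGrad_le hF hb hv hρ.le f hf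
  rw [← hw] at h1
  have h2 : (ρ * dualLocalNorm 𝒦 F (grad 𝒦 F v) f) ^ 2 ≤ ρ ^ 2 := by
    have h0 : 0 ≤ dualLocalNorm 𝒦 F (grad 𝒦 F v) f := Real.sqrt_nonneg _
    have : ρ * dualLocalNorm 𝒦 F (grad 𝒦 F v) f ≤ ρ := mul_le_of_le_one_right hρ.le hf1
    gcongr
  -- Since `μ - v` lies in `L`, the projection in `grad_dualGrad` is invisible.
  have h3 : ⟪grad 𝒦 F w, μ - v⟫_ℝ = ⟪grad 𝒦 F v, μ - v⟫_ℝ - ρ * ⟪f, μ - v⟫_ℝ := by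
    rw [hw, grad_dualGrad hF hb, ← real_inner_smul_left, ← inner_sub_left]
    exact Submodule.inner_orthogonalProjectionOnto_eq_of_mem_right
      (⟨μ - v, sub_mem_vectorSpan hv hμ⟩ : vectorSpan ℝ 𝒦) _ |>.trans rfl
  have h4 : bregman 𝒦 F μ w
      = bregman 𝒦 F μ v + bregman 𝒦 F v w + ρ * (⟪μ, f⟫_ℝ - ⟪v, f⟫_ℝ) := by
    have h5 : ⟪grad 𝒦 F w, μ - w⟫_ℝ
        = ⟪grad 𝒦 F w, μ - v⟫_ℝ + ⟪grad 𝒦 F w, v - w⟫_ℝ := by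
      rw [← inner_add_right, sub_add_sub_cancel]
    rw [bregman, bregman, bregman, h5, h3, inner_sub_right f, real_inner_comm μ f,
      real_inner_comm v f]
    ring
  have h6 : 1 / ρ * bregman 𝒦 F μ w = 1 / ρ * bregman 𝒦 F μ v + 1 / ρ * bregman 𝒦 F v w
      + (⟪μ, f⟫_ℝ - ⟪v, f⟫_ℝ) := by
    rw [h4]
    field_simp
  have h7 : 1 / ρ * bregman 𝒦 F v w ≤ 2 * ρ := by
    rw [one_div, inv_mul_le_iff₀ hρ]
    nlinarith
  rw [inner_neg_right]
  linarith

/-! ### The relaxation -/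

theorem mirrorIterate_concat {ρ : ℝ} {ν₁ : EuclideanSpace ℝ ι} (h : List (EuclideanSpace ℝ ι))
    (f : EuclideanSpace ℝ ι) :
    mirrorIterate 𝒦 F ρ ν₁ (h ++ [f])
      = dualGrad 𝒦 F (grad 𝒦 F (mirrorIterate 𝒦 F ρ ν₁ h) - ρ • f) := by
  simp [mirrorIterate]

theorem mirrorIterate_mem (hF : IsMirrorBarrier 𝒦 F) (hb : Bornology.IsBounded 𝒦) {ρ : ℝ}
    {ν₁ : EuclideanSpace ℝ ι} (hν₁ : ν₁ ∈ relInt 𝒦) (h : List (EuclideanSpace ℝ ι)) :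
    mirrorIterate 𝒦 F ρ ν₁ h ∈ relInt 𝒦 := by
  rcases h.eq_nil_or_concat with rfl | ⟨h, f, rfl⟩
  · exact hν₁
  · rw [List.concat_eq_append, mirrorIterate_concat]
    exact dualGrad_mem hF hb _

theorem inner_add_mirrorRelaxation_le (hF : IsMirrorBarrier 𝒦 F) (hb : Bornology.IsBounded 𝒦)
    {ρ : ℝ} (hρ : 0 < ρ) {ν₁ : EuclideanSpace ℝ ι} (hν₁ : ν₁ ∈ relInt 𝒦) (T : ℕ)
    {C : Set (EuclideanSpace ℝ ι)} (hC : C ⊆ relInt 𝒦) (h : List (EuclideanSpace ℝ ι))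
    (f : EuclideanSpace ℝ ι)
    (hf : ρ * dualLocalNorm 𝒦 F (grad 𝒦 F (mirrorIterate 𝒦 F ρ ν₁ h)) f ≤ 1 / 2)
    (hf1 : dualLocalNorm 𝒦 F (grad 𝒦 F (mirrorIterate 𝒦 F ρ ν₁ h)) f ≤ 1) :
    ((⟪mirrorIterate 𝒦 F ρ ν₁ h, f⟫_ℝ : ℝ) : EReal) + mirrorRelaxation 𝒦 F ρ ν₁ T C (h ++ [f])
      ≤ mirrorRelaxation 𝒦 F ρ ν₁ T C h := by
  rw [mirrorRelaxation, add_left_comm, ← EReal.coe_add]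
  -- Moving the finite constant across allows the supremum to be bounded for each `μ` separately,
  -- including when `C` is empty.
  refine EReal.add_le_of_le_sub (iSup₂_le fun μ hμ => ?_)
  rw [EReal.le_sub_iff_add_le (Or.inl (EReal.coe_ne_bot _)) (Or.inl (EReal.coe_ne_top _)),
    ← EReal.coe_add, mirrorRelaxation]
  refine le_trans ?_ (add_le_add_left (le_iSup₂_of_le μ hμ le_rfl) _)
  rw [← EReal.coe_add, EReal.coe_le_coe_iff, mirrorIterate_concat]
  have := inner_add_bregman_dualGrad_le hF hb (hC hμ) (mirrorIterate_mem hF hb hν₁ h) hρ f hf hf1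
  simp only [List.map_append, List.sum_append, List.map_cons, List.map_nil, List.sum_cons,
    List.sum_nil, List.length_append, List.length_cons, List.length_nil]
  push_cast
  linarith

theorem neg_iInf_le_mirrorRelaxation (hF : IsMirrorBarrier 𝒦 F) (hb : Bornology.IsBounded 𝒦)
    {ρ : ℝ} (hρ : 0 < ρ) {ν₁ : EuclideanSpace ℝ ι} (hν₁ : ν₁ ∈ relInt 𝒦)
    {C : Set (EuclideanSpace ℝ ι)} (hC : C ⊆ relInt 𝒦) (h : List (EuclideanSpace ℝ ι)) :
    -(⨅ ν ∈ C, (((h.map fun f => ⟪ν, f⟫_ℝ).sum : ℝ) : EReal))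
      ≤ mirrorRelaxation 𝒦 F ρ ν₁ h.length C h := by
  rw [EReal.neg_le]
  refine le_iInf₂ fun μ hμ => ?_
  rw [EReal.neg_le, mirrorRelaxation, sub_self, mul_zero, EReal.coe_zero, add_zero]
  refine le_iSup₂_of_le μ hμ ?_
  rw [← EReal.coe_neg, EReal.coe_le_coe_iff]
  have h1 := bregman_nonneg hF.toIsSelfConcordantBarrier hF.strictConvexOn (hC hμ)
    (mirrorIterate_mem hF hb (ρ := ρ) hν₁ h)
  have h2 : (h.map fun f => ⟪μ, -f⟫_ℝ).sum = -(h.map fun f => ⟪μ, f⟫_ℝ).sum := by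
    rw [List.sum_neg, List.map_map]
    simp [Function.comp_def, inner_neg_right]
  rw [h2]
  have : 0 ≤ 1 / ρ * bregman 𝒦 F μ (mirrorIterate 𝒦 F ρ ν₁ h) := by positivity
  linarith

end Transfer

/-! ### The state-action polytope and the main theorem -/

theorem isBounded_stateActionPolytope {X U : Type*} [Fintype X] [Fintype U]
    (K : X → U → stdSimplex ℝ X) : Bornology.IsBounded (stateActionPolytope K) := by
  refine isBounded_iff_forall_norm_le.2 ⟨1, fun v hv => ?_⟩
  rw [EuclideanSpace.norm_eq, Real.sqrt_le_one]
  have hle : ∀ p, v p ≤ 1 := fun p =>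
    hv.2.1 ▸ Finset.single_le_sum (f := fun p => v p) (fun p _ => hv.1 p) (Finset.mem_univ p)
  calc ∑ p, ‖v p‖ ^ 2 ≤ ∑ p, v p := Finset.sum_le_sum fun p _ => by
        rw [Real.norm_of_nonneg (hv.1 p), sq]
        exact mul_le_of_le_one_left (hv.1 p) (hle p)
    _ = 1 := hv.2.1

end OnlineMDP

end

theorem proposition5 {X U : Type*} [Fintype X] [Fintype U] (K : X → U → stdSimplex ℝ X)
    (F : EuclideanSpace ℝ (X × U) → ℝ)
    (hF : OnlineMDP.IsMirrorBarrier (OnlineMDP.stateActionPolytope K) F)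
    (G' : Set (EuclideanSpace ℝ (X × U)))
    (hG' : G' ⊆ OnlineMDP.relInt (OnlineMDP.stateActionPolytope K))
    (𝓕 : Set (EuclideanSpace ℝ (X × U))) (T : ℕ) (ρ : ℝ) (hρ : 0 < ρ)
    (ν₁ : EuclideanSpace ℝ (X × U))
    (hν₁ : ν₁ ∈ OnlineMDP.relInt (OnlineMDP.stateActionPolytope K))
    (hmin : IsMinOn F (OnlineMDP.relInt (OnlineMDP.stateActionPolytope K)) ν₁)
    (hstep : ∀ h : List (EuclideanSpace ℝ (X × U)), (∀ g ∈ h, g ∈ 𝓕) → h.length < T →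
      ∀ f ∈ 𝓕, ρ * OnlineMDP.dualLocalNorm (OnlineMDP.stateActionPolytope K) F
        (OnlineMDP.grad (OnlineMDP.stateActionPolytope K) F
          (OnlineMDP.mirrorIterate (OnlineMDP.stateActionPolytope K) F ρ ν₁ h)) f ≤ 1 / 2)
    (hnorm : ∀ h : List (EuclideanSpace ℝ (X × U)), (∀ g ∈ h, g ∈ 𝓕) → h.length < T →
      ∀ f ∈ 𝓕, OnlineMDP.dualLocalNorm (OnlineMDP.stateActionPolytope K) F
        (OnlineMDP.grad (OnlineMDP.stateActionPolytope K) F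
          (OnlineMDP.mirrorIterate (OnlineMDP.stateActionPolytope K) F ρ ν₁ h)) f ≤ 1) :
    OnlineMDP.IsAdmissibleRelaxation T 𝓕
      (OnlineMDP.relInt (OnlineMDP.stateActionPolytope K)) G'
      (OnlineMDP.mirrorRelaxation (OnlineMDP.stateActionPolytope K) F ρ ν₁ T G') ∧
    OnlineMDP.IsAdmissibleStrategy T 𝓕
      (OnlineMDP.relInt (OnlineMDP.stateActionPolytope K))
      (OnlineMDP.mirrorRelaxation (OnlineMDP.stateActionPolytope K) F ρ ν₁ T G')
      (OnlineMDP.mirrorIterate (OnlineMDP.stateActionPolytope K) F ρ ν₁) ∧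
    ((∀ h : List (EuclideanSpace ℝ (X × U)), (∀ g ∈ h, g ∈ 𝓕) → h.length < T →
        OnlineMDP.mirrorIterate (OnlineMDP.stateActionPolytope K) F ρ ν₁ h ∈ G') →
      OnlineMDP.IsAdmissibleRelaxation T 𝓕 G' G'
        (OnlineMDP.mirrorRelaxation (OnlineMDP.stateActionPolytope K) F ρ ν₁ T G')) := by
  have hb := OnlineMDP.isBounded_stateActionPolytope K
  have hmem := OnlineMDP.mirrorIterate_mem hF hb (ρ := ρ) hν₁
  have hle : ∀ h : List (EuclideanSpace ℝ (X × U)), (∀ g ∈ h, g ∈ 𝓕) → h.length < T →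
      (⨆ f ∈ 𝓕, ((⟪OnlineMDP.mirrorIterate (OnlineMDP.stateActionPolytope K) F ρ ν₁ h, f⟫_ℝ : ℝ) :
          EReal) + OnlineMDP.mirrorRelaxation (OnlineMDP.stateActionPolytope K) F ρ ν₁ T G'
            (h ++ [f]))
        ≤ OnlineMDP.mirrorRelaxation (OnlineMDP.stateActionPolytope K) F ρ ν₁ T G' h :=
    fun h hh hT => iSup₂_le fun f hf => OnlineMDP.inner_add_mirrorRelaxation_le hF hb hρ hν₁ T hG'
      h f (hstep h hh hT f hf) (hnorm h hh hT f hf)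
  have hterm : ∀ h : List (EuclideanSpace ℝ (X × U)), (∀ g ∈ h, g ∈ 𝓕) → h.length = T →
      -(⨅ ν ∈ G', (((h.map fun f => ⟪ν, f⟫_ℝ).sum : ℝ) : EReal))
        ≤ OnlineMDP.mirrorRelaxation (OnlineMDP.stateActionPolytope K) F ρ ν₁ T G' h :=
    fun h _ hT => hT ▸ OnlineMDP.neg_iInf_le_mirrorRelaxation hF hb hρ hν₁ hG' h
  -- The iterate is the witness for the infimum over decisions, and remains one over `G'` whenever
  -- it lies there.
  exact ⟨⟨fun h hh hT => iInf₂_le_of_le _ (hmem h) (hle h hh hT), hterm⟩,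
    ⟨fun h _ _ => hmem h, hle⟩,
    fun hG => ⟨fun h hh hT => iInf₂_le_of_le _ (hG h hh hT) (hle h hh hT), hterm⟩⟩
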